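/- For positive integers $n,d$ let $\mathcal D=\{-1/\sqrt d,\,1/\sqrt d\}^d\subset\mathbb R^d$, and for a dataset $D=(x_1,\dots,x_n)\in\mathcal D^n$ let $\bar D=\frac1n\sum_{i=1}^n x_i$. A mechanism $\mathcal M$ assigns to each $D\in\mathcal D^n$ a random vector $\mathcal M(D)$ in $\mathbb R^d$; it is $(\varepsilon,\delta)$-DP if $\mathbb P[\mathcal M(D)\in S]\le e^{\varepsilon}\,\mathbb P[\mathcal M(D')\in S]+\delta$ for all measurable $S\subseteq\mathbb R^d$ and all $D,D'\in\mathcal D^n$ that differ in at most one of the $n$ records. There are absolute constants $\kappa,c>0$ such that the following holds for all integers $n,d\ge1$, all $0<\varepsilon\le\kappa d$ (in particular for all $\varepsilon\le\kappa$ in every dimension, and, for any constant $C$, for all $\varepsilon\le C$ once $d\ge C/\kappa$), and all $$\delta\in\Bigl(\exp\bigl(-4d\log(d)\log^2(nd)\bigr),\ 4\,n^{-d}\log^{-2d}(8d)\Bigr).$$ For every $(\varepsilon,\delta)$-DP mechanism $\mathcal M$ there is a dataset $D\in\mathcal D^n$ such that, with probability at least $1/4$ over the randomness of $\mathcal M$,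 $$\|\mathcal M(D)-\bar D\|_2\ \ge\ c\,\min\Bigl\{1,\ \frac{\sqrt{d\log(1/\delta)}}{\varepsilon n\,\log(d)\,\log(nd)}\Bigr\}.$$ That is, the error is $\tilde\Omega\bigl(\min\{1,\sqrt{d\log(1/\delta)}/(\varepsilon n)\}\bigr)$, where $\tilde\Omega$ hides polylogarithmic factors in $n$ and $d$ only. (For $d=1$ the range of $\delta$ is empty.) -/

import Mathlib

open MeasureTheory

noncomputable section

/-- The data universe `{-1/√d, 1/√d}^d`, as a set of vectors of `ℝ^d` with the Euclidean norm. -/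
def signCube (d : ℕ) : Set (EuclideanSpace ℝ (Fin d)) :=
  {x | ∀ j, x j = -(1 / √(d : ℝ)) ∨ x j = 1 / √(d : ℝ)}

/-- Datasets of `n` records, each a point of `{-1/√d, 1/√d}^d`. -/
abbrev Dataset (n d : ℕ) : Type := Fin n → signCube d

/-- Neighboring datasets: they differ in at most one record. -/
def Neighboring {n d : ℕ} (D D' : Dataset n d) : Prop :=
  {i | D i ≠ D' i}.Subsingleton

/-- A randomized mechanism with outputs in `ℝ^d`: `M D` is the law of the output on input `D`. -/
abbrev Mechanism (n d : ℕ) : Type :=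
  Dataset n d → ProbabilityMeasure (EuclideanSpace ℝ (Fin d))

/-- `(ε, δ)`-differential privacy. -/
def IsDP {n d : ℕ} (ε δ : ℝ) (M : Mechanism n d) : Prop :=
  ∀ D D' : Dataset n d, Neighboring D D' →
    ∀ S : Set (EuclideanSpace ℝ (Fin d)), MeasurableSet S →
      (M D : Measure (EuclideanSpace ℝ (Fin d))).real S ≤
        Real.exp ε * (M D' : Measure (EuclideanSpace ℝ (Fin d))).real S + δ

/-- The empirical mean `(1/n) ∑ xᵢ` of a dataset. -/
def empMean {n d : ℕ} (D : Dataset n d) : EuclideanSpace ℝ (Fin d) :=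
  (n : ℝ)⁻¹ • ∑ i, (D i : EuclideanSpace ℝ (Fin d))

end

noncomputable section

/-! This is a packing argument. For each of the `2 ^ d` sign patterns, put `k` copies of its cube
point into a fixed dataset. If every error is small with probability above `3 / 4`, group privacy
gives the ball around each resulting mean mass at least about `exp (-d / 8)` under one common output
law (`IsDP.prefixDataset_le`). Each point lies in at most `(19 / 15) ^ d` of the balls
(`card_hammingBall_le`), so the total mass is too large. Taking `k` near `min n (d / (8 * ε))` gives
error of order `min 1 (d / (ε * n))`, which dominates the claimed rate because `δ` is not too small
(`rate_le_of_exp_lt_delta`). -/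

/-- The point of `{-1/√d, 1/√d}^d` with sign pattern `v`. -/
def signVec {d : ℕ} (v : Fin d → Bool) : signCube d :=
  ⟨WithLp.toLp 2 fun j => if v j then 1 / √(d : ℝ) else -(1 / √(d : ℝ)), fun j => by
    by_cases h : v j <;> simp [h]⟩

/-- The dataset whose first `k` records are `x` and whose other records are `y`. -/
def prefixDataset {d : ℕ} (n k : ℕ) (x y : signCube d) : Dataset n d :=
  fun i => if (i : ℕ) < k then x else y

theorem sum_pow_hammingDist {d : ℕ} (v : Fin d → Bool) (t : ℝ) :
    ∑ w : Fin d → Bool, t ^ hammingDist v w = (1 + t) ^ d := by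
  have h1 : ∀ w : Fin d → Bool,
      t ^ hammingDist v w = ∏ j, if v j ≠ w j then t else 1 := by
    intro w
    rw [hammingDist, Finset.prod_ite]
    simp
  simp_rw [h1]
  have h2 := Finset.prod_univ_sum (fun _ : Fin d => (Finset.univ : Finset Bool))
    (fun j b => if v j ≠ b then t else (1 : ℝ))
  rw [Fintype.piFinset_univ] at h2
  rw [← h2]
  have h3 : ∀ j : Fin d, ∑ b : Bool, (if v j ≠ b then t else (1 : ℝ)) = 1 + t := by
    intro j
    cases v j <;> simp [add_comm]
  rw [Finset.prod_congr rfl fun j _ => h3 j]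
  simp

/-- Chernoff bound: weight `w` by `t ^ hammingDist v w` with `t = (5 / 6) ^ 16`, which is at least
`(5 / 6) ^ d` on the ball. -/
theorem card_hammingBall_le {d : ℕ} (v : Fin d → Bool) :
    ((Finset.univ.filter fun w : Fin d → Bool => 16 * hammingDist v w ≤ d).card : ℝ)
      ≤ (19 / 15 : ℝ) ^ d := by
  set S := Finset.univ.filter fun w : Fin d → Bool => 16 * hammingDist v w ≤ d
  have h1 : (S.card : ℝ) * (5 / 6 : ℝ) ^ d ≤ (1 + (5 / 6 : ℝ) ^ 16) ^ d := by
    calc (S.card : ℝ) * (5 / 6 : ℝ) ^ d = ∑ w ∈ S, (5 / 6 : ℝ) ^ d := by simp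
      _ ≤ ∑ w ∈ S, ((5 / 6 : ℝ) ^ 16) ^ hammingDist v w := by
          refine Finset.sum_le_sum fun w hw => ?_
          rw [← pow_mul]
          exact pow_le_pow_of_le_one (by norm_num) (by norm_num) (Finset.mem_filter.1 hw).2
      _ ≤ ∑ w, ((5 / 6 : ℝ) ^ 16) ^ hammingDist v w :=
          Finset.sum_le_sum_of_subset_of_nonneg (Finset.subset_univ _) fun _ _ _ => by positivity
      _ = _ := sum_pow_hammingDist v _
  have h2 : (1 + (5 / 6 : ℝ) ^ 16) ^ d ≤ (19 / 15 : ℝ) ^ d * (5 / 6 : ℝ) ^ d := by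
    rw [← mul_pow]
    exact pow_le_pow_left₀ (by norm_num) (by norm_num) d
  exact le_of_mul_le_mul_right (h1.trans h2) (by positivity)

theorem norm_signVec_sub_sq {d : ℕ} (hd : 1 ≤ d) (v w : Fin d → Bool) :
    ‖(signVec v : EuclideanSpace ℝ (Fin d)) - signVec w‖ ^ 2 = 4 * hammingDist v w / d := by
  have hd' : (0 : ℝ) < d := by exact_mod_cast hd
  have h : ∀ j, ‖((signVec v : EuclideanSpace ℝ (Fin d)) - signVec w) j‖ ^ 2
      = if v j ≠ w j then 4 / (d : ℝ) else 0 := by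
    intro j
    have hs : (√(d : ℝ))⁻¹ ^ 2 = (d : ℝ)⁻¹ := by
      rw [inv_pow, Real.sq_sqrt hd'.le]
    rw [Real.norm_eq_abs, sq_abs]
    cases hv : v j <;> cases hw : w j <;> simp [signVec, hv, hw] <;>
      linear_combination 4 * hs
  rw [EuclideanSpace.norm_sq_eq]
  simp_rw [h]
  rw [Finset.sum_ite]
  simp [hammingDist]
  ring

theorem empMean_prefixDataset_sub {n d k : ℕ} (hk : k ≤ n) (x x' y : signCube d) :
    empMean (prefixDataset n k x y) - empMean (prefixDataset n k x' y)
      = ((k : ℝ) / n) • ((x : EuclideanSpace ℝ (Fin d)) - x') := by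
  rw [empMean, empMean, ← smul_sub, ← Finset.sum_sub_distrib]
  have h : ∀ i : Fin n,
      ((prefixDataset n k x y i : EuclideanSpace ℝ (Fin d)) - prefixDataset n k x' y i)
        = if (i : ℕ) < k then (x : EuclideanSpace ℝ (Fin d)) - x' else 0 := by
    intro i
    unfold prefixDataset
    split_ifs <;> simp
  simp_rw [h]
  rw [Fin.sum_univ_eq_sum_range
    (fun i => if i < k then (x : EuclideanSpace ℝ (Fin d)) - x' else 0) n,
    ← Finset.sum_filter]
  have h2 : (Finset.range n).filter (· < k) = Finset.range k := by
    ext i; simp; omega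
  rw [h2, Finset.sum_const, Finset.card_range, ← Nat.cast_smul_eq_nsmul ℝ, smul_smul]
  congr 1
  ring

theorem neighboring_prefixDataset_succ {n d k : ℕ} (x y : signCube d) :
    Neighboring (prefixDataset n (k + 1) x y) (prefixDataset n k x y) := by
  have h : ∀ i ∈ {i | prefixDataset n (k + 1) x y i ≠ prefixDataset n k x y i}, (i : ℕ) = k := by
    intro i hi
    by_contra hne
    apply hi
    unfold prefixDataset
    have : (i : ℕ) < k + 1 ↔ (i : ℕ) < k := by omega
    simp [this]
  intro i hi j hj
  exact Fin.ext ((h i hi).trans (h j hj).symm)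

/-- Group privacy along the interpolating datasets `prefixDataset n k x y`. -/
theorem IsDP.prefixDataset_le {n d : ℕ} {ε δ : ℝ} (hε : 0 ≤ ε) (hδ : 0 ≤ δ) {M : Mechanism n d}
    (hM : IsDP ε δ M) (x y : signCube d) {S : Set (EuclideanSpace ℝ (Fin d))}
    (hS : MeasurableSet S) (k : ℕ) :
    (M (prefixDataset n k x y) : Measure (EuclideanSpace ℝ (Fin d))).real S
      ≤ Real.exp (k * ε)
        * ((M (prefixDataset n 0 x y) : Measure (EuclideanSpace ℝ (Fin d))).real S + k * δ) := by
  induction k with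
  | zero => simp
  | succ k ih =>
    have h1 := hM _ _ (neighboring_prefixDataset_succ (k := k) x y) S hS
    have h2 := mul_le_mul_of_nonneg_left ih (Real.exp_pos ε).le
    have h3 : Real.exp ((k + 1 : ℕ) * ε) = Real.exp ε * Real.exp (k * ε) := by
      rw [← Real.exp_add]; push_cast; ring_nf
    -- The new `δ` is absorbed at the cost of the full exponential factor.
    have h4 : (1 : ℝ) ≤ Real.exp ((k + 1 : ℕ) * ε) := Real.one_le_exp (by positivity)
    rw [h3] at h4 ⊢
    push_cast
    nlinarith [mul_le_mul_of_nonneg_right h4 hδ]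

/-- Double counting: integrate the pointwise bound on the sum of indicators. -/
theorem sum_measureReal_le_of_forall_card_le {Ω ι : Type*} [MeasurableSpace Ω] [Fintype ι]
    (μ : Measure Ω) [IsProbabilityMeasure μ] (B : ι → Set Ω) (hB : ∀ i, MeasurableSet (B i))
    (V : ℝ) (hV : ∀ y, ∀ T : Finset ι, (∀ i ∈ T, y ∈ B i) → (T.card : ℝ) ≤ V) :
    ∑ i, μ.real (B i) ≤ V := by
  classical
  have hint : ∀ i, Integrable ((B i).indicator (1 : Ω → ℝ)) μ := fun i =>
    (integrable_const (1 : ℝ)).indicator (hB i)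
  calc ∑ i, μ.real (B i) = ∑ i, ∫ y, (B i).indicator (1 : Ω → ℝ) y ∂μ := by
        simp_rw [fun i => integral_indicator_one (μ := μ) (hB i)]
    _ = ∫ y, ∑ i, (B i).indicator (1 : Ω → ℝ) y ∂μ :=
        (integral_finsetSum _ fun i _ => hint i).symm
    _ ≤ ∫ _, V ∂μ := by
        refine integral_mono (integrable_finsetSum _ fun i _ => hint i) (integrable_const V) ?_
        intro y
        have h := hV y (Finset.univ.filter fun i => y ∈ B i) (by simp)
        simpa [Set.indicator_apply, Finset.sum_ite] using h
    _ = V := by simp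

theorem packing_numeric {d : ℕ} (hd : 2 ≤ d) :
    (19 / 15 : ℝ) ^ d + 4 * (2 / 7 : ℝ) ^ d < 3 / 4 * (7 / 4 : ℝ) ^ d := by
  induction d, hd using Nat.le_induction with
  | base => norm_num
  | succ d _ ih =>
    have h1 : (0 : ℝ) < (2 / 7) ^ d := by positivity
    have h2 : (0 : ℝ) < (7 / 4) ^ d := by positivity
    rw [pow_succ, pow_succ, pow_succ]
    nlinarith

/-- Packing bound: a mechanism all of whose errors are below `k / (4 n)` with probability more than
`3 / 4` cannot be private with `k ε ≤ d / 8` and tiny `δ`. -/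
theorem exists_error_ge_of_isDP {n d k : ℕ} {ε δ r : ℝ} (hd : 2 ≤ d) (hk : 1 ≤ k) (hkn : k ≤ n)
    (hε : 0 ≤ ε) (hδ : 0 ≤ δ) (hkε : k * ε ≤ d / 8) (hkδ : k * δ ≤ 4 / 7 ^ d)
    (hr : r ≤ k / (4 * n)) {M : Mechanism n d} (hM : IsDP ε δ M) :
    ∃ D : Dataset n d,
      1 / 4 ≤ (M D : Measure (EuclideanSpace ℝ (Fin d))).real {y | r ≤ ‖y - empMean D‖} := by
  by_contra! hcon
  have hd0 : (0 : ℝ) < d := by exact_mod_cast (by omega : 0 < d)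
  have hk0 : (0 : ℝ) < k := by exact_mod_cast hk
  have hn0 : (0 : ℝ) < n := by exact_mod_cast (by omega : 0 < n)
  let y₀ : signCube d := signVec fun _ => true
  let D : (Fin d → Bool) → Dataset n d := fun v => prefixDataset n k (signVec v) y₀
  let D₀ : Dataset n d := prefixDataset n 0 y₀ y₀
  let B : (Fin d → Bool) → Set (EuclideanSpace ℝ (Fin d)) :=
    fun v => {y | r ≤ ‖y - empMean (D v)‖}ᶜ
  have hBm : ∀ v, MeasurableSet (B v) := fun v =>
    (measurableSet_le measurable_const (by fun_prop)).compl
  have hD₀ : ∀ v, prefixDataset n 0 (signVec v) y₀ = D₀ := fun v => by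
    funext i; simp [D₀, prefixDataset]
  have hlow : ∀ v, 3 / 4 * Real.exp (-(d / 8)) - 4 / 7 ^ d
      ≤ (M D₀ : Measure (EuclideanSpace ℝ (Fin d))).real (B v) := by
    intro v
    have h1 : 3 / 4 ≤ (M (D v) : Measure (EuclideanSpace ℝ (Fin d))).real (B v) := by
      have hm : MeasurableSet {y | r ≤ ‖y - empMean (D v)‖} :=
        measurableSet_le measurable_const (by fun_prop)
      rw [probReal_compl_eq_one_sub hm]
      linarith [hcon (D v)]
    have h2 := hM.prefixDataset_le hε hδ (signVec v) y₀ (hBm v) k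
    rw [hD₀] at h2
    have h3 : Real.exp (k * ε) ≤ Real.exp (d / 8) := Real.exp_le_exp.2 hkε
    set p := (M D₀ : Measure (EuclideanSpace ℝ (Fin d))).real (B v)
    have hp : 0 ≤ p := measureReal_nonneg
    have h4 : 3 / 4 ≤ Real.exp (d / 8) * (p + 4 / 7 ^ d) :=
      (h1.trans h2).trans (by gcongr)
    have h5 := mul_le_mul_of_nonneg_left h4 (Real.exp_pos (-(d / 8 : ℝ))).le
    rw [← mul_assoc, ← Real.exp_add, neg_add_cancel, Real.exp_zero] at h5
    linarith
  have hup : ∑ v, (M D₀ : Measure (EuclideanSpace ℝ (Fin d))).real (B v) ≤ (19 / 15 : ℝ) ^ d := by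
    refine sum_measureReal_le_of_forall_card_le _ B hBm _ fun y T hT => ?_
    rcases T.eq_empty_or_nonempty with rfl | ⟨v, hv⟩
    · simp; positivity
    -- Means of balls sharing `y` are within `k / (2 * n)`, so the cube points are within `1 / 2`,
    -- i.e. `4 * hammingDist v w / d ≤ 1 / 4`.
    refine le_trans ?_ (card_hammingBall_le v)
    refine Nat.cast_le.2 (Finset.card_le_card fun w hw => ?_)
    refine Finset.mem_filter.2 ⟨Finset.mem_univ _, ?_⟩
    have h1 : ‖y - empMean (D v)‖ < r := not_le.1 (hT v hv)
    have h2 : ‖y - empMean (D w)‖ < r := not_le.1 (hT w hw)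
    have h3 : ‖empMean (D v) - empMean (D w)‖ ≤ k / n * (1 / 2) := by
      have h := norm_sub_le (y - empMean (D w)) (y - empMean (D v))
      rw [sub_sub_sub_cancel_left] at h
      have : (k : ℝ) / n * (1 / 2) = 2 * (k / (4 * n)) := by field_simp; norm_num
      linarith
    rw [empMean_prefixDataset_sub hkn, norm_smul, Real.norm_of_nonneg (by positivity)] at h3
    have h4 := le_of_mul_le_mul_left h3 (by positivity)
    have h5 := pow_le_pow_left₀ (norm_nonneg _) h4 2
    rw [norm_signVec_sub_sq (by omega), div_le_iff₀ hd0] at h5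
    have h6 : (16 : ℝ) * hammingDist v w ≤ d := by linarith
    exact_mod_cast h6
  have hsum : (2 : ℝ) ^ d * (3 / 4 * Real.exp (-(d / 8)) - 4 / 7 ^ d) ≤ (19 / 15 : ℝ) ^ d := by
    refine le_trans ?_ hup
    have h := Finset.card_nsmul_le_sum Finset.univ _ _ fun v _ => hlow v
    simpa using h
  have hexp : (7 / 8 : ℝ) ^ d ≤ Real.exp (-(d / 8)) := by
    have h : (7 / 8 : ℝ) ≤ Real.exp (-(1 / 8)) := by
      linarith [Real.add_one_le_exp (-(1 / 8) : ℝ)]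
    calc (7 / 8 : ℝ) ^ d ≤ Real.exp (-(1 / 8)) ^ d := pow_le_pow_left₀ (by norm_num) h d
      _ = Real.exp (-(d / 8)) := by rw [← Real.exp_nat_mul]; ring_nf
  have hnum := packing_numeric hd
  have e1 : (2 : ℝ) ^ d * (7 / 8) ^ d = (7 / 4) ^ d := by rw [← mul_pow]; norm_num
  have e2 : (2 : ℝ) ^ d * (4 / 7 ^ d) = 4 * (2 / 7) ^ d := by rw [div_pow]; ring
  have h7 := mul_le_mul_of_nonneg_left hexp (by positivity : (0 : ℝ) ≤ 2 ^ d)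
  nlinarith

theorem mul_le_of_lt_delta_bound {n d : ℕ} {δ : ℝ} (hn : 1 ≤ n) (hd : 2 ≤ d)
    (h : δ < 4 / ((n : ℝ) ^ d * Real.log (8 * d) ^ (2 * d))) : n * δ ≤ 4 / 7 ^ d := by
  have hn1 : (1 : ℝ) ≤ n := by exact_mod_cast hn
  have hd2 : (2 : ℝ) ≤ d := by exact_mod_cast hd
  -- The base `7` comes from `(log 16) ^ 2 > 7`.
  have hlog : (7 : ℝ) ≤ Real.log (8 * d) ^ 2 := by
    have h16 : Real.log 16 = 4 * Real.log 2 := by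
      rw [show (16 : ℝ) = 2 ^ 4 by norm_num, Real.log_pow]; norm_num
    have hle : Real.log 16 ≤ Real.log (8 * d) := Real.log_le_log (by norm_num) (by linarith)
    nlinarith [Real.log_two_gt_d9]
  have h7 : (7 : ℝ) ^ d ≤ Real.log (8 * d) ^ (2 * d) := by
    rw [pow_mul]; exact pow_le_pow_left₀ (by norm_num) hlog d
  have hnd : (n : ℝ) ≤ (n : ℝ) ^ d := le_self_pow₀ hn1 (by omega)
  have h8 : (4 : ℝ) / ((n : ℝ) ^ d * Real.log (8 * d) ^ (2 * d)) ≤ 4 / (n * 7 ^ d) := by gcongr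
  calc n * δ ≤ n * (4 / (n * 7 ^ d)) := by gcongr; exact h.le.trans h8
    _ = 4 / 7 ^ d := by field_simp

theorem rate_le_of_exp_lt_delta {n d : ℕ} {ε δ : ℝ} (hn : 1 ≤ n) (hd : 2 ≤ d) (hε : 0 < ε)
    (h : Real.exp (-(4 * d * Real.log d * Real.log (n * d) ^ 2)) < δ) :
    √(d * Real.log (1 / δ)) / (ε * n * (Real.log d * Real.log (n * d))) ≤ 4 * d / (ε * n) := by
  have hn1 : (1 : ℝ) ≤ n := by exact_mod_cast hn
  have hd2 : (2 : ℝ) ≤ d := by exact_mod_cast hd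
  have hδ : 0 < δ := (Real.exp_pos _).trans h
  have ha : 1 / 2 < Real.log d :=
    lt_of_lt_of_le (by linarith [Real.log_two_gt_d9]) (Real.log_le_log (by norm_num) hd2)
  have hb : 0 < Real.log (n * d) := Real.log_pos (by nlinarith)
  have hL : Real.log (1 / δ) ≤ 4 * d * Real.log d * Real.log (n * d) ^ 2 := by
    rw [one_div, Real.log_inv]
    linarith [(Real.lt_log_iff_exp_lt hδ).2 h]
  have hs : √(d * Real.log (1 / δ)) ≤ 4 * d * (Real.log d * Real.log (n * d)) := by
    refine Real.sqrt_le_iff.2 ⟨by positivity, ?_⟩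
    calc d * Real.log (1 / δ) ≤ d * (4 * d * Real.log d * Real.log (n * d) ^ 2) := by gcongr
      -- A factor `4 * log d ≥ 1` completes the square.
      _ = (4 * d ^ 2 * Real.log d * Real.log (n * d) ^ 2) * 1 := by ring
      _ ≤ (4 * d ^ 2 * Real.log d * Real.log (n * d) ^ 2) * (4 * Real.log d) := by
          gcongr; linarith
      _ = (4 * d * (Real.log d * Real.log (n * d))) ^ 2 := by ring
  rw [div_le_div_iff₀ (by positivity) (by positivity)]
  calc √(d * Real.log (1 / δ)) * (ε * n)
      ≤ 4 * d * (Real.log d * Real.log (n * d)) * (ε * n) := by gcongr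
    _ = 4 * d * (ε * n * (Real.log d * Real.log (n * d))) := by ring

/-- For `d = 1` the range of `δ` is empty. -/
theorem two_le_of_delta_range {n d : ℕ} {δ : ℝ} (hn : 1 ≤ n) (hd : 1 ≤ d)
    (h1 : Real.exp (-(4 * d * Real.log d * Real.log (n * d) ^ 2)) < δ)
    (h2 : δ < 4 / ((n : ℝ) ^ d * Real.log (8 * d) ^ (2 * d))) : 2 ≤ d := by
  by_contra hlt
  obtain rfl : d = 1 := by omega
  have hn1 : (1 : ℝ) ≤ n := by exact_mod_cast hn
  have h8 : Real.log 8 = 3 * Real.log 2 := by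
    rw [show (8 : ℝ) = 2 ^ 3 by norm_num, Real.log_pow]; norm_num
  have h4 : (4 : ℝ) ≤ Real.log 8 ^ 2 := by nlinarith [Real.log_two_gt_d9]
  -- The lower end of the range is now `exp 0 = 1`, while the upper end is at most `1`.
  simp only [Nat.cast_one, Real.log_one, mul_zero, zero_mul, neg_zero, Real.exp_zero, mul_one,
    pow_one] at h1 h2
  have h5 := h1.trans h2
  rw [lt_div_iff₀ (by positivity)] at h5
  nlinarith

end

/-- Lower bound for `(ε, δ)`-DP mean estimation with exponentially small `δ`. The constants `κ`, `c`
are absolute. The range `ε ≤ κ d` contains every `ε ≤ κ` for all `d`, and every `ε ≤ C`, for any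
fixed `C`, as soon as `d ≥ C / κ`. -/
theorem theorem10 :
    ∃ κ : ℝ, 0 < κ ∧ ∃ c : ℝ, 0 < c ∧
      ∀ n d : ℕ, 1 ≤ n → 1 ≤ d →
      ∀ ε δ : ℝ, 0 < ε → ε ≤ κ * d →
      Real.exp (-(4 * d * Real.log d * Real.log (n * d) ^ 2)) < δ →
      δ < 4 / ((n : ℝ) ^ d * Real.log (8 * d) ^ (2 * d)) →
      ∀ M : Mechanism n d, IsDP ε δ M →
      ∃ D : Dataset n d,
        1 / 4 ≤ (M D : MeasureTheory.Measure (EuclideanSpace ℝ (Fin d))).real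
          {y | c * min 1 (√(d * Real.log (1 / δ)) / (ε * n * (Real.log d * Real.log (n * d))))
                ≤ ‖y - empMean D‖} := by
  refine ⟨1 / 8, by norm_num, 1 / 256, by norm_num, ?_⟩
  intro n d hn hd ε δ hε hεd hδl hδu M hM
  have hd2 := two_le_of_delta_range hn hd hδl hδu
  have hδ : 0 < δ := (Real.exp_pos _).trans hδl
  have hn0 : (0 : ℝ) < n := by exact_mod_cast hn
  have hd0 : (0 : ℝ) < d := by exact_mod_cast hd
  have hrate := rate_le_of_exp_lt_delta hn hd2 hε hδl
  have hnδ := mul_le_of_lt_delta_bound hn hd2 hδu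
  -- The real group size with privacy cost exactly `d / 8`; `κ = 1 / 8` makes it at least `1`.
  set q : ℝ := d / (8 * ε) with hq
  have hq1 : 1 ≤ q := by rw [hq, le_div_iff₀ (by positivity)]; linarith
  have hfloor : (⌊q⌋₊ : ℝ) ≤ q := Nat.floor_le (by linarith)
  have hfloor1 : 1 ≤ ⌊q⌋₊ := Nat.one_le_floor_iff q |>.2 hq1
  have hqε : q * ε = d / 8 := by rw [hq]; field_simp
  refine exists_error_ge_of_isDP (k := min n ⌊q⌋₊) hd2 (le_min hn hfloor1) (min_le_left _ _) hε.le
    hδ.le ?_ ?_ ?_ hM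
  · have h : ((min n ⌊q⌋₊ : ℕ) : ℝ) ≤ q :=
      le_trans (by exact_mod_cast min_le_right _ _) hfloor
    exact (mul_le_mul_of_nonneg_right h hε.le).trans hqε.le
  · have h : ((min n ⌊q⌋₊ : ℕ) : ℝ) ≤ n := by exact_mod_cast min_le_left _ _
    exact (mul_le_mul_of_nonneg_right h hδ.le).trans hnδ
  · rcases le_total n ⌊q⌋₊ with h | h
    · rw [min_eq_left h]
      calc _ ≤ 1 / 256 * (1 : ℝ) := by gcongr; exact min_le_left _ _
        _ ≤ n / (4 * n) := by field_simp; norm_num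
    · rw [min_eq_right h]
      -- Rounding loses at most a factor `2`, and `c = 1 / 256` makes the equality below exact.
      have hhalf : q / 2 ≤ (⌊q⌋₊ : ℝ) := by
        have h1 : (1 : ℝ) ≤ ⌊q⌋₊ := by exact_mod_cast hfloor1
        linarith [Nat.lt_floor_add_one q]
      calc _ ≤ 1 / 256 * (4 * d / (ε * n)) := by gcongr; exact (min_le_right _ _).trans hrate
        _ = (q / 2) / (4 * n) := by rw [hq]; field_simp; norm_num
        _ ≤ ⌊q⌋₊ / (4 * n) := by gcongr
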